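/- Let $X$ be a (Hausdorff) complex manifold of pure complex dimension $n \ge 2$ and let $M \subset X$ be a domain, i.e. a nonempty connected open subset, whose topological boundary $\partial M$ is compact and nonempty. Suppose that $\partial M$ is smooth and strongly pseudoconvex: every $p \in \partial M$ has an open neighbourhood $U$ in $X$ with a $C^\infty$ function $\varphi : U \to \mathbb{R}$ such that $d\varphi \neq 0$ everywhere on $U$, $M \cap U = \{x \in U : \varphi(x) < 0\}$, and the complex Hessian $\left(\frac{\partial^2 \varphi}{\partial z_i \, \partial \bar z_j}\right)$ in local holomorphic coordinates is positive definite at every point of $U$. Let $\beta : M \to \mathbb{R}$ be a pluriharmonic function (a $C^2$ function with $\partial\bar\partial\beta = 0$) that vanishes at $\partial M$, i.e. $\beta(x) \to 0$ as $x \in M$ tends to any point of $\partial M$. Then $\beta$ vanishes identically on $M$. -/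

import Mathlib

open scoped Manifold ContDiff Topology

noncomputable section

/-- The complex Hessian (Levi form) of a real function `f` on a complex normed space, at `z`,
evaluated on the vector `v`:
`¼ (D²f(z)(v, v) + D²f(z)(iv, iv)) = ∑ (∂²f / ∂zᵢ ∂z̄ⱼ)(z) vᵢ v̄ⱼ` in linear coordinates. -/
def leviForm {E : Type*} [NormedAddCommGroup E] [NormedSpace ℂ E]
    (f : E → ℝ) (z v : E) : ℝ :=
  (1 / 4 : ℝ) * (iteratedFDeriv ℝ 2 f z ![v, v]
    + iteratedFDeriv ℝ 2 f z ![Complex.I • v, Complex.I • v])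

/-- The complex Hessian of a real function `f` on a complex manifold `X` at the point `x`, read in
the preferred holomorphic chart at `x` (which identifies the tangent space at `x` with `E`).
Its vanishing and its positivity do not depend on the holomorphic chart. -/
def complexHessian {E : Type*} [NormedAddCommGroup E] [NormedSpace ℂ E]
    {X : Type*} [TopologicalSpace X] [ChartedSpace E X] (f : X → ℝ) (x : X) (v : E) : ℝ :=
  leviForm (f ∘ (chartAt E x).symm) (chartAt E x x) v

/-- `f` is pluriharmonic on the open set `M`: it is of class `C²` there (in the real sense) and
`∂∂̄f = 0`. Values of `f` outside `M` play no role. -/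
def IsPluriharmonicOn (E : Type*) [NormedAddCommGroup E] [NormedSpace ℂ E]
    {X : Type*} [TopologicalSpace X] [ChartedSpace E X] (f : X → ℝ) (M : Set X) : Prop :=
  ContMDiffOn 𝓘(ℝ, E) 𝓘(ℝ, ℝ) 2 f M ∧ ∀ x ∈ M, ∀ v : E, complexHessian f x v = 0

/-- The open set `M` has smooth strongly pseudoconvex (strictly Levi-convex) boundary: near every
boundary point it is the set `{φ < 0}` for a smooth real function `φ` without critical points whose
complex Hessian is positive definite. -/
def HasStronglyPseudoconvexBoundary (E : Type*) [NormedAddCommGroup E] [NormedSpace ℂ E]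
    {X : Type*} [TopologicalSpace X] [ChartedSpace E X] (M : Set X) : Prop :=
  ∀ p ∈ frontier M, ∃ (U : Set X) (φ : X → ℝ), IsOpen U ∧ p ∈ U ∧
    ContMDiffOn 𝓘(ℝ, E) 𝓘(ℝ, ℝ) ∞ φ U ∧
    (∀ x ∈ U, mfderiv 𝓘(ℝ, E) 𝓘(ℝ, ℝ) φ x ≠ 0) ∧
    (∀ x ∈ U, x ∈ M ↔ φ x < 0) ∧
    (∀ x ∈ U, ∀ v : E, v ≠ 0 → 0 < complexHessian φ x v)

end

/-!
The function `β`, extended by zero outside `M`, is continuous on `X`. Two facts give the theorem: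
`β` vanishes near some point of `M`, and then on all of `M` by the identity theorem.

*Vanishing near a boundary point `p`.* Work in a holomorphic chart centred at `a`, and let `P` be the
Levi polynomial at `a` of a strictly plurisubharmonic defining function `φ`. It is holomorphic with
`P a = 0`, and `φ ≥ Re P + c ‖z - a‖²` near `a` (`exists_levi_polynomial`), so
`Re P ≤ -c ‖z - a‖²` on `M`. Hence a level set `{P = s}` with `s` close to `0` meets `M` near `a` in
a set whose boundary lies in `∂M`, where `β = 0`. As `n ≥ 2`, these level sets have positive
dimension, and the maximum principle on them gives `β ≤ 0`, and `β ≥ 0` by symmetry. To avoid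
parametrising the level sets, which may be singular, the maximum principle is applied on a full ball
to `β + ε N - K ‖P - s‖²`, where `N` is strictly plurisubharmonic: at an interior maximum in `M` the
complex Hessian would be positive on the kernel of `dP`
(`nonpos_of_re_lt_of_pluriharmonic`).

*Identity theorem.* On complex lines in a chart `β` is harmonic, hence real analytic
(`eqOn_zero_ball_of_pluriharmonic`), so the interior of its zero set is relatively closed in the
connected set `M`.

The complex Hessian in the hypotheses is read in a chart that depends on the point. That
pluriharmonicity can be read in one fixed chart follows from the invariance of the complex Hessian
under holomorphic maps (`leviForm_comp`).
-/

/-! ### The complex Hessian and holomorphic maps -/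

section LeviForm

variable {E F : Type*} [NormedAddCommGroup E] [NormedSpace ℂ E]
  [NormedAddCommGroup F] [NormedSpace ℂ F]

theorem Filter.EventuallyEq.leviForm_eq {f g : E → ℝ} {z : E} (h : f =ᶠ[𝓝 z] g) (v : E) :
    leviForm f z v = leviForm g z v := by
  simp only [leviForm, (h.iteratedFDeriv ℝ 2).self_of_nhds]

theorem leviForm_zero_right (f : E → ℝ) (z : E) : leviForm f z 0 = 0 := by
  simp [leviForm, iteratedFDeriv_two_apply]

theorem leviForm_add {f g : E → ℝ} {z : E} (hf : ContDiffAt ℝ 2 f z) (hg : ContDiffAt ℝ 2 g z)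
    (v : E) : leviForm (fun y ↦ f y + g y) z v = leviForm f z v + leviForm g z v := by
  have h : iteratedFDeriv ℝ 2 (fun y ↦ f y + g y) z
      = iteratedFDeriv ℝ 2 f z + iteratedFDeriv ℝ 2 g z := iteratedFDeriv_add_apply hf hg
  simp only [leviForm, h, add_apply]
  ring

theorem leviForm_const_mul (c : ℝ) {f : E → ℝ} {z : E} (hf : ContDiffAt ℝ 2 f z)
    (v : E) : leviForm (fun y ↦ c * f y) z v = c * leviForm f z v := by
  have h : iteratedFDeriv ℝ 2 (c • f) z = c • iteratedFDeriv ℝ 2 f z :=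
    iteratedFDeriv_const_smul_apply hf
  change leviForm (c • f) z v = _
  simp only [leviForm, h, smul_apply, smul_eq_mul]
  ring

/-- The second derivative of a composition `f ∘ g` with `g` holomorphic. -/
theorem fderiv_fderiv_comp_holomorphic {f : F → ℝ} {g : E → F} {z : E}
    (hf : ContDiffAt ℝ 2 f (g z)) (hg : ContDiffAt ℂ 2 g z) (v w : E) :
    fderiv ℝ (fderiv ℝ (f ∘ g)) z v w
      = fderiv ℝ (fderiv ℝ f) (g z) (fderiv ℂ g z v) (fderiv ℂ g z w)
        + fderiv ℝ f (g z) (fderiv ℂ (fderiv ℂ g) z v w) := by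
  have hgR : ContDiffAt ℝ 2 g z := hg.restrict_scalars ℝ
  have hfg : ContDiffAt ℝ 2 (f ∘ g) z := hf.comp z hgR
  have hdf : DifferentiableAt ℝ (fderiv ℝ f) (g z) :=
    (hf.fderiv_right (m := 1) (by norm_num)).differentiableAt (by norm_num)
  have hdg : DifferentiableAt ℂ (fderiv ℂ g) z :=
    (hg.fderiv_right (m := 1) (by norm_num)).differentiableAt (by norm_num)
  have hdfg : DifferentiableAt ℝ (fderiv ℝ (f ∘ g)) z :=
    (hfg.fderiv_right (m := 1) (by norm_num)).differentiableAt (by norm_num)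
  have hgd : HasFDerivAt g ((fderiv ℂ g z).restrictScalars ℝ) z :=
    (hg.differentiableAt (by norm_num)).hasFDerivAt.restrictScalars ℝ
  have hev : (fun y ↦ fderiv ℝ (f ∘ g) y w) =ᶠ[𝓝 z]
      fun y ↦ fderiv ℝ f (g y) (fderiv ℂ g y w) := by
    filter_upwards [hgR.continuousAt.eventually (hf.eventually (by simp)),
      hg.eventually (by simp)] with y hfy hgy
    have h1 := (hfy.differentiableAt (by norm_num)).hasFDerivAt.comp y
      ((hgy.differentiableAt (by norm_num)).hasFDerivAt.restrictScalars ℝ)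
    rw [h1.fderiv]
    rfl
  have h1 : HasFDerivAt (fun y ↦ fderiv ℝ (f ∘ g) y w)
      ((fderiv ℝ (fderiv ℝ (f ∘ g)) z).flip w) z := by
    simpa using hdfg.hasFDerivAt.clm_apply (hasFDerivAt_const w z)
  have h2 := (hdf.hasFDerivAt.comp z hgd).clm_apply
    ((hdg.hasFDerivAt.clm_apply (hasFDerivAt_const w z)).restrictScalars ℝ)
  have h3 := (h1.congr_of_eventuallyEq hev.symm).unique h2
  have h4 := congrArg (fun T ↦ T v) h3
  simpa [add_comm] using h4

/-- Invariance of the complex Hessian under holomorphic maps: the term of the real chain rule that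
involves the second derivative of `g` is complex bilinear, so `v` and `i v` cancel each other. -/
theorem leviForm_comp {f : F → ℝ} {g : E → F} {z : E}
    (hf : ContDiffAt ℝ 2 f (g z)) (hg : ContDiffAt ℂ 2 g z) (v : E) :
    leviForm (f ∘ g) z v = leviForm f (g z) (fderiv ℂ g z v) := by
  simp only [leviForm, iteratedFDeriv_two_apply, fderiv_fderiv_comp_holomorphic hf hg]
  have h : fderiv ℂ (fderiv ℂ g) z (Complex.I • v) (Complex.I • v)
      = - fderiv ℂ (fderiv ℂ g) z v v := by
    rw [map_smul, map_smul, smul_apply, smul_smul, Complex.I_mul_I, neg_one_smul]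
  simp only [Matrix.cons_val_zero, Matrix.cons_val_one, h, map_neg, map_smul (fderiv ℂ g z)]
  ring

/-- Second derivative of the quadratic function of a bilinear form. -/
theorem fderiv_fderiv_bilin {V : Type*} [NormedAddCommGroup V] [NormedSpace ℝ V]
    (B : V →L[ℝ] V →L[ℝ] ℝ) (a z v w : V) :
    fderiv ℝ (fderiv ℝ (fun y ↦ B (y - a) (y - a))) z v w = B v w + B w v := by
  have hd (y : V) : HasFDerivAt (fun y ↦ y - a) (ContinuousLinearMap.id ℝ V) y :=
    (hasFDerivAt_id y).sub_const a
  have h1 : fderiv ℝ (fun y ↦ B (y - a) (y - a)) = fun y ↦ B (y - a) + B.flip (y - a) := by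
    ext y u
    have h := (B.hasFDerivAt.comp y (hd y)).clm_apply (hd y)
    simp only [Function.comp_apply] at h
    rw [h.fderiv]
    simp
  have h2 : HasFDerivAt (fun y ↦ B (y - a) + B.flip (y - a)) (B + B.flip) z := by
    exact (B.hasFDerivAt.comp z (hd z)).add (B.flip.hasFDerivAt.comp z (hd z))
  rw [h1, h2.fderiv]
  simp

theorem contDiff_bilin {V : Type*} [NormedAddCommGroup V] [NormedSpace ℝ V]
    (B : V →L[ℝ] V →L[ℝ] ℝ) (a : V) {n : WithTop ℕ∞} :
    ContDiff ℝ n (fun y ↦ B (y - a) (y - a)) := by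
  fun_prop

end LeviForm

/-! ### Second order conditions at critical points -/

section SecondOrder

variable {V : Type*} [NormedAddCommGroup V] [NormedSpace ℝ V]

/-- The second order necessary condition at a local maximum. -/
theorem IsLocalMax.fderiv_fderiv_nonpos {u : V → ℝ} {q : V} (h : IsLocalMax u q)
    (hu : ContDiffAt ℝ 2 u q) (v : V) : fderiv ℝ (fderiv ℝ u) q v v ≤ 0 := by
  by_contra! hpos
  set l : ℝ → V := fun t ↦ q + t • v with hl
  have hl0 : l 0 = q := by simp [hl]
  have hld (t : ℝ) : HasDerivAt l v t := by
    simpa [hl] using ((hasDerivAt_id t).smul_const v).const_add q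
  have hlc : Filter.Tendsto l (𝓝 0) (𝓝 q) := by
    simpa [hl0] using (hld 0).continuousAt.tendsto
  have hd1 : deriv (u ∘ l) =ᶠ[𝓝 0] fun t ↦ fderiv ℝ u (l t) v := by
    filter_upwards [hlc.eventually (hu.eventually (by simp))] with t ht
    exact ((ht.differentiableAt (by norm_num)).hasFDerivAt.comp_hasDerivAt t (hld t)).deriv
  have hdu : HasFDerivAt (fderiv ℝ u) (fderiv ℝ (fderiv ℝ u) q) (l 0) := by
    rw [hl0]
    exact ((hu.fderiv_right (m := 1) (by norm_num)).differentiableAt (by norm_num)).hasFDerivAt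
  have hd2 : deriv (deriv (u ∘ l)) 0 = fderiv ℝ (fderiv ℝ u) q v v := by
    rw [hd1.deriv_eq]
    simpa using ((hdu.comp_hasDerivAt 0 (hld 0)).clm_apply (hasDerivAt_const 0 v)).deriv
  have hmax : IsLocalMax (u ∘ l) 0 := by
    have : ∀ᶠ y in 𝓝 q, u y ≤ u q := h
    filter_upwards [hlc.eventually this] with t ht
    simpa [hl0] using ht
  have hmin : IsLocalMin (u ∘ l) 0 :=
    isLocalMin_of_deriv_deriv_pos (hd2 ▸ hpos) hmax.deriv_eq_zero
      (ContinuousAt.comp (by rw [hl0]; exact hu.continuousAt) (hld 0).continuousAt)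
  -- Both a maximum and a minimum along the line: locally constant there.
  have hconst : u ∘ l =ᶠ[𝓝 0] fun _ ↦ (u ∘ l) 0 := by
    filter_upwards [hmax, hmin] with t h1 h2
    exact le_antisymm h1 h2
  have : deriv (deriv (u ∘ l)) 0 = 0 := by
    rw [hconst.deriv.deriv_eq]
    simp
  linarith

/-- Quadratic growth at a critical point with positive definite second derivative, by integrating
along segments the lower bound for the first derivative. -/
theorem eventually_quadratic_growth {G : V → ℝ} {a : V} {m : ℝ} (hm : 0 < m)
    (hG : ContDiffAt ℝ 2 G a) (h1 : fderiv ℝ G a = 0)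
    (h2 : ∀ v, m * ‖v‖ ^ 2 ≤ fderiv ℝ (fderiv ℝ G) a v v) :
    ∀ᶠ z in 𝓝 a, G a + m / 4 * ‖z - a‖ ^ 2 ≤ G z := by
  have hd : HasFDerivAt (fderiv ℝ G) (fderiv ℝ (fderiv ℝ G) a) a :=
    ((hG.fderiv_right (m := 1) (by norm_num)).differentiableAt (by norm_num)).hasFDerivAt
  have ho := hd.isLittleO.bound (half_pos hm)
  obtain ⟨r, hr, hball⟩ := Metric.eventually_nhds_iff_ball.1 (ho.and (hG.eventually (by simp)))
  filter_upwards [Metric.ball_mem_nhds a hr] with z hz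
  set w := z - a with hw
  have hmem {t : ℝ} (ht : t ∈ Set.Icc (0 : ℝ) 1) : a + t • w ∈ Metric.ball a r := by
    rw [mem_ball_iff_norm] at hz ⊢
    rw [add_sub_cancel_left, norm_smul, Real.norm_of_nonneg ht.1]
    nlinarith [ht.2, norm_nonneg w]
  have hder {t : ℝ} (ht : t ∈ Set.Icc (0 : ℝ) 1) :
      HasDerivAt (fun t : ℝ ↦ G (a + t • w) - m / 4 * ‖w‖ ^ 2 * t ^ 2)
        (fderiv ℝ G (a + t • w) w - m / 4 * ‖w‖ ^ 2 * (2 * t)) t := by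
    have hl : HasDerivAt (fun t : ℝ ↦ a + t • w) w t := by
      simpa using ((hasDerivAt_id t).smul_const w).const_add a
    have := ((hball _ (hmem ht)).2.differentiableAt
      (by norm_num)).hasFDerivAt.comp_hasDerivAt t hl
    refine this.sub ?_
    simpa using ((hasDerivAt_pow 2 t).const_mul (m / 4 * ‖w‖ ^ 2))
  have hmono : MonotoneOn (fun t : ℝ ↦ G (a + t • w) - m / 4 * ‖w‖ ^ 2 * t ^ 2)
      (Set.Icc 0 1) := by
    refine monotoneOn_of_deriv_nonneg (convex_Icc 0 1)
      (fun t ht ↦ (hder ht).continuousAt.continuousWithinAt)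
      (fun t ht ↦ (hder (interior_subset ht)).differentiableAt.differentiableWithinAt) ?_
    intro t ht
    have ht' := interior_subset ht
    rw [(hder ht').deriv]
    have hb := (hball _ (hmem ht')).1
    rw [h1, sub_zero, add_sub_cancel_left] at hb
    have hb' := ((fderiv ℝ G (a + t • w) - fderiv ℝ (fderiv ℝ G) a (t • w)).le_opNorm w).trans
      (mul_le_mul_of_nonneg_right hb (norm_nonneg w))
    rw [norm_smul, Real.norm_of_nonneg ht'.1, Real.norm_eq_abs] at hb'
    have hb2 := (abs_le.1 hb').1
    simp only [sub_apply, map_smul, smul_apply,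
      smul_eq_mul] at hb2
    nlinarith [mul_le_mul_of_nonneg_left (h2 w) ht'.1]
  have := hmono (Set.left_mem_Icc.2 zero_le_one) (Set.right_mem_Icc.2 zero_le_one) zero_le_one
  simp only [zero_smul, add_zero, one_smul, hw, add_sub_cancel] at this
  rw [hw]
  linarith

end SecondOrder

/-! ### The Levi polynomial and the maximum principle on its level sets -/

section Peak

variable {E : Type*} [NormedAddCommGroup E] [NormedSpace ℂ E]

theorem map_complex_smul_eq (l : E →L[ℝ] ℝ) (c : ℂ) (v : E) :
    l (c • v) = c.re * l v + c.im * l (Complex.I • v) := by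
  have : c • v = c.re • v + c.im • (Complex.I • v) := by
    conv_lhs => rw [← Complex.re_add_im c]
    rw [add_smul, mul_smul, Complex.coe_smul, Complex.coe_smul]
  rw [this, map_add, map_smul, map_smul, smul_eq_mul, smul_eq_mul]

theorem map_I_smul_complex_smul (l : E →L[ℝ] ℝ) (c : ℂ) (v : E) :
    l (Complex.I • c • v) = c.re * l (Complex.I • v) - c.im * l v := by
  rw [smul_smul, map_complex_smul_eq]
  simp
  ring

/-- A real linear functional is the real part of a complex linear one. -/
theorem exists_complex_linear_re_eq [FiniteDimensional ℂ E] (l : E →L[ℝ] ℝ) :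
    ∃ L : E →L[ℂ] ℂ, ∀ v, (L v).re = l v := by
  let L : E →ₗ[ℂ] ℂ :=
    { toFun := fun v ↦ ⟨l v, -l (Complex.I • v)⟩
      map_add' := fun v w ↦ by apply Complex.ext <;> simp [add_comm]
      map_smul' := fun c v ↦ by
        apply Complex.ext
        · simp [map_complex_smul_eq l c]
        · simp [map_I_smul_complex_smul l c]
          ring }
  exact ⟨L.toContinuousLinearMap, fun v ↦ rfl⟩

/-- The part of type `(2, 0)` of a real bilinear form, up to a factor, as the real part of a complex
bilinear form. -/
theorem exists_complex_bilin_re_eq [FiniteDimensional ℂ E] (H : E →L[ℝ] E →L[ℝ] ℝ) :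
    ∃ B : E →L[ℂ] E →L[ℂ] ℂ, ∀ v w, (B v w).re = H v w - H (Complex.I • v) (Complex.I • w) := by
  have hr (c : ℂ) (v w : E) : H v (c • w) = c.re * H v w + c.im * H v (Complex.I • w) :=
    map_complex_smul_eq (H v) c w
  have hrI (c : ℂ) (v w : E) :
      H v (Complex.I • c • w) = c.re * H v (Complex.I • w) - c.im * H v w :=
    map_I_smul_complex_smul (H v) c w
  have hl (c : ℂ) (v w : E) : H (c • v) w = c.re * H v w + c.im * H (Complex.I • v) w :=
    map_complex_smul_eq (H.flip w) c v
  have hlI (c : ℂ) (v w : E) :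
      H (Complex.I • c • v) w = c.re * H (Complex.I • v) w - c.im * H v w :=
    map_I_smul_complex_smul (H.flip w) c v
  let B : E →ₗ[ℂ] E →ₗ[ℂ] ℂ := LinearMap.mk₂ ℂ
    (fun v w ↦ ⟨H v w - H (Complex.I • v) (Complex.I • w),
      -H v (Complex.I • w) - H (Complex.I • v) w⟩)
    (fun v v' w ↦ by apply Complex.ext <;> simp <;> ring)
    (fun c v w ↦ by
      apply Complex.ext
      · simp only [hl c, hlI c, smul_eq_mul, Complex.mul_re]; ring
      · simp only [hl c, hlI c, smul_eq_mul, Complex.mul_im]; ring)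
    (fun v w w' ↦ by apply Complex.ext <;> simp <;> ring)
    (fun c v w ↦ by
      apply Complex.ext
      · simp only [hr c, hrI c, smul_eq_mul, Complex.mul_re]; ring
      · simp only [hr c, hrI c, smul_eq_mul, Complex.mul_im]; ring)
  exact ⟨(LinearMap.toContinuousLinearMap.toLinearMap ∘ₗ B).toContinuousLinearMap,
    fun v w ↦ rfl⟩

/-- The Levi polynomial `P` of `f` at `a`: it is holomorphic, and by strict plurisubharmonicity
`f` exceeds `f a + Re P` quadratically near `a`. -/
theorem exists_levi_polynomial [FiniteDimensional ℂ E] {f : E → ℝ} {a : E}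
    (hf : ContDiffAt ℝ 2 f a) (hpos : ∀ v, v ≠ 0 → 0 < leviForm f a v) :
    ∃ (P : E → ℂ) (c : ℝ), ContDiff ℂ 2 P ∧ P a = 0 ∧ 0 < c ∧
      ∀ᶠ z in 𝓝 a, f a + (P z).re + c * ‖z - a‖ ^ 2 ≤ f z := by
  have : ProperSpace E := FiniteDimensional.proper ℂ E
  set H := fderiv ℝ (fderiv ℝ f) a with hH
  have hlevi (v : E) : leviForm f a v = 1 / 4 * (H v v + H (Complex.I • v) (Complex.I • v)) := by
    simp [leviForm, iteratedFDeriv_two_apply, hH]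
  obtain ⟨m, hm, hmle⟩ : ∃ m : ℝ, 0 < m ∧ ∀ v, m * ‖v‖ ^ 2 ≤ leviForm f a v := by
    obtain ⟨m, hm, hmle⟩ := (isCompact_sphere (0 : E) 1).exists_forall_le' (a := (0 : ℝ))
      (f := leviForm f a) (by
        have : leviForm f a = fun v ↦ 1 / 4 * (H v v + H (Complex.I • v) (Complex.I • v)) :=
          funext hlevi
        rw [this]
        fun_prop)
      (fun v hv ↦ hpos v (ne_zero_of_mem_unit_sphere ⟨v, hv⟩))
    refine ⟨m, hm, fun v ↦ ?_⟩
    rcases eq_or_ne v 0 with rfl | hv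
    · simp [leviForm_zero_right]
    have hv' : ‖v‖ ≠ 0 := norm_ne_zero_iff.2 hv
    have h1 := hmle (‖v‖⁻¹ • v) (by simp [norm_smul, hv'])
    have h2 : leviForm f a (‖v‖⁻¹ • v) = (‖v‖⁻¹) ^ 2 * leviForm f a v := by
      simp only [hlevi, smul_comm Complex.I, map_smul, smul_apply, smul_eq_mul]
      ring
    rw [h2, inv_pow, inv_mul_eq_div, le_div_iff₀ (by positivity)] at h1
    exact h1
  obtain ⟨L, hL⟩ := exists_complex_linear_re_eq (fderiv ℝ f a)
  obtain ⟨B, hB⟩ := exists_complex_bilin_re_eq H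
  refine ⟨fun z ↦ L (z - a) + 1 / 4 * B (z - a) (z - a), m / 2, by fun_prop, by simp, by positivity,
    ?_⟩
  -- The real parts are written with real linear maps, to differentiate them over `ℝ`.
  set J : E →L[ℝ] E := (Complex.I • ContinuousLinearMap.id ℂ E).restrictScalars ℝ with hJ
  have hJv (v : E) : J v = Complex.I • v := rfl
  set Q : E →L[ℝ] E →L[ℝ] ℝ := (1 / 4 : ℝ) • (H - H.bilinearComp J J) with hQ
  have hQv (v w : E) : Q v w = 1 / 4 * (H v w - H (Complex.I • v) (Complex.I • w)) := by
    simp [hQ, hJv]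
  have hre (z : E) : (L (z - a) + 1 / 4 * B (z - a) (z - a)).re
      = fderiv ℝ f a (z - a) + Q (z - a) (z - a) := by
    rw [hQv, ← hL, ← hB, Complex.add_re]
    congr 1
    rw [show (1 / 4 : ℂ) = ((1 / 4 : ℝ) : ℂ) by norm_num, Complex.re_ofReal_mul]
  set G : E → ℝ := fun z ↦ f z - (fderiv ℝ f a (z - a) + Q (z - a) (z - a)) with hGdef
  have hG : ContDiffAt ℝ 2 G a :=
    hf.sub (ContDiff.contDiffAt (by fun_prop))
  have hq := contDiff_bilin Q a (n := 2)
  have hGd : fderiv ℝ G =ᶠ[𝓝 a] fun z ↦ fderiv ℝ f z -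
      (fderiv ℝ f a + fderiv ℝ (fun y ↦ Q (y - a) (y - a)) z) := by
    filter_upwards [hf.eventually (by simp)] with z hz
    have h1 : HasFDerivAt (fun y : E ↦ fderiv ℝ f a (y - a)) (fderiv ℝ f a) z :=
      (fderiv ℝ f a).hasFDerivAt.comp z ((hasFDerivAt_id z).sub_const a)
    exact ((hz.differentiableAt (by norm_num)).hasFDerivAt.sub
      (h1.add (hq.differentiable (by norm_num) z).hasFDerivAt)).fderiv
  have hQ0 : fderiv ℝ (fun y ↦ Q (y - a) (y - a)) a = 0 := by
    have h1 : HasFDerivAt (fun y : E ↦ y - a) (ContinuousLinearMap.id ℝ E) a :=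
      (hasFDerivAt_id a).sub_const a
    have h2 := (Q.hasFDerivAt.comp a h1).clm_apply h1
    simp only [Function.comp_apply] at h2
    rw [h2.fderiv]
    ext u
    simp
  have hG2 (v : E) : fderiv ℝ (fderiv ℝ G) a v v = 2 * leviForm f a v := by
    have h1 := ((hf.fderiv_right (m := 1) (by norm_num)).differentiableAt (by norm_num)).hasFDerivAt
    have h2 := ((hq.fderiv_right (m := 1) (by norm_num)).differentiable (by norm_num) a).hasFDerivAt
    have h3 : HasFDerivAt (fderiv ℝ G)
        (fderiv ℝ (fderiv ℝ f) a - fderiv ℝ (fderiv ℝ fun y ↦ Q (y - a) (y - a)) a) a :=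
      (h1.sub (h2.const_add (fderiv ℝ f a))).congr_of_eventuallyEq hGd
    rw [h3.fderiv, sub_apply, sub_apply, fderiv_fderiv_bilin, hQv, hlevi, ← hH]
    ring
  have hgrow := eventually_quadratic_growth (m := 2 * m) (by positivity) hG
    (by simpa only [hQ0, add_zero, sub_self] using hGd.self_of_nhds)
    (fun v ↦ by rw [hG2]; linarith [hmle v])
  filter_upwards [hgrow] with z hz
  have ha : G a = f a := by simp [hGdef]
  rw [hre]
  rw [ha] at hz
  have : G z = f z - (fderiv ℝ f a (z - a) + Q (z - a) (z - a)) := rfl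
  nlinarith

/-- There is a nonnegative `C²` function with positive definite complex Hessian: the square of a
Euclidean norm (that of `E` itself need not be differentiable). -/
theorem exists_nonneg_leviForm_pos [FiniteDimensional ℂ E] :
    ∃ N : E → ℝ, ContDiff ℝ 2 N ∧ (∀ z, 0 ≤ N z) ∧ ∀ z v, v ≠ 0 → 0 < leviForm N z v := by
  let T : E ≃L[ℝ] EuclideanSpace ℝ (Fin (Module.finrank ℝ E)) :=
    ContinuousLinearEquiv.ofFinrankEq (by simp)
  let B : E →L[ℝ] E →L[ℝ] ℝ :=
    (innerSL ℝ).bilinearComp T.toContinuousLinearMap T.toContinuousLinearMap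
  have hB (v : E) : B v v = ‖T v‖ ^ 2 := real_inner_self_eq_norm_sq (T v)
  refine ⟨fun y ↦ B (y - 0) (y - 0), contDiff_bilin B 0,
    fun z ↦ (sq_nonneg _).trans_eq (hB (z - 0)).symm,
    fun z v hv ↦ ?_⟩
  have h1 : 0 < ‖T v‖ := norm_pos_iff.2 (by simpa using hv)
  simp only [leviForm, iteratedFDeriv_two_apply, fderiv_fderiv_bilin B, Matrix.cons_val_zero,
    Matrix.cons_val_one]
  simp only [hB]
  positivity

/-- The maximum principle on the level sets `{P = s}` of a holomorphic function, which are
positive dimensional as `2 ≤ dim E`, in penalised form: `b + ε N - K ‖P - s‖²`, with `N` strictly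
plurisubharmonic, has no local maximum in `Ω`, because its complex Hessian is positive on the kernel
of the differential of `P`. -/
theorem nonpos_of_re_lt_of_pluriharmonic [FiniteDimensional ℂ E]
    (hdim : 2 ≤ Module.finrank ℂ E) {Ω : Set E} {a : E} {r c : ℝ}
    {b : E → ℝ} (hbc : ContinuousOn b (Metric.closedBall a r))
    (hb0 : ∀ z ∈ Metric.closedBall a r, z ∉ Ω → b z = 0)
    (hb : ∀ z ∈ Metric.ball a r, z ∈ Ω → ContDiffAt ℝ 2 b z ∧ ∀ v, leviForm b z v = 0)
    {P : E → ℂ} (hP : ContDiff ℂ 2 P)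
    (hre : ∀ z ∈ Metric.closedBall a r, z ∈ Ω → (P z).re ≤ -(c * ‖z - a‖ ^ 2))
    {z₀ : E} (hz₀ : z₀ ∈ Metric.closedBall a r) (hlt : -(c * r ^ 2) < (P z₀).re) :
    b z₀ ≤ 0 := by
  have : ProperSpace E := FiniteDimensional.proper ℂ E
  obtain ⟨N, hN, hN0, hNpos⟩ := exists_nonneg_leviForm_pos (E := E)
  have hcpt := isCompact_closedBall a r
  obtain ⟨R, hR⟩ := hcpt.bddAbove_image hN.continuous.continuousOn
  obtain ⟨C, hC⟩ := hcpt.bddAbove_image hbc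
  replace hR (z) (hz : z ∈ Metric.closedBall a r) : N z ≤ R := hR (Set.mem_image_of_mem _ hz)
  replace hC (z) (hz : z ∈ Metric.closedBall a r) : b z ≤ C := hC (Set.mem_image_of_mem _ hz)
  set s := P z₀ with hs
  set δ := s.re + c * r ^ 2 with hδ
  have hδ0 : 0 < δ := by linarith
  -- The value of `K` for which the penalty is at least `|C|` where `δ ≤ ‖P z - s‖`.
  set K := |C| / δ ^ 2 with hK
  have hK0 : 0 ≤ K := by positivity
  have hRnn : 0 ≤ R := (hN0 z₀).trans (hR z₀ hz₀)
  have key : ∀ ε > 0, b z₀ ≤ ε * R := by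
    intro ε hε
    set u : E → ℝ := fun z ↦ (b z + ε * N z) + -K * ‖P z - s‖ ^ 2 with hu
    have huc : ContinuousOn u (Metric.closedBall a r) := by
      have h1 := hN.continuous
      have h2 := hP.continuous
      exact (hbc.add (by fun_prop)).add (by fun_prop)
    obtain ⟨q, hq, hmax⟩ := hcpt.exists_isMaxOn ⟨z₀, hz₀⟩ huc
    have hz : b z₀ ≤ u q := by
      have h1 : u z₀ ≤ u q := hmax hz₀
      have h2 : u z₀ = b z₀ + ε * N z₀ := by simp [hu, hs]
      nlinarith [hN0 z₀]
    refine hz.trans ?_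
    have hεN : ε * N q ≤ ε * R := mul_le_mul_of_nonneg_left (hR q hq) hε.le
    by_cases hqΩ : q ∈ Ω
    · rcases (Metric.mem_closedBall.1 hq).lt_or_eq with hqb | hqs
      · exfalso
        have hqb : q ∈ Metric.ball a r := hqb
        have hlocal : IsLocalMax u q :=
          hmax.isLocalMax (Filter.mem_of_superset (Metric.isOpen_ball.mem_nhds hqb)
            Metric.ball_subset_closedBall)
        obtain ⟨hbC, hbL⟩ := hb q hqb hqΩ
        -- This is where the dimension is used: a linear functional on `E` has a nonzero kernel.
        obtain ⟨v, hv, hv0⟩ : ∃ v : E, fderiv ℂ P q v = 0 ∧ v ≠ 0 := by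
          have h1 : 0 < Module.finrank ℂ (LinearMap.ker (fderiv ℂ P q).toLinearMap) := by
            have h2 := LinearMap.finrank_range_add_finrank_ker (fderiv ℂ P q).toLinearMap
            have h3 := Submodule.finrank_le (LinearMap.range (fderiv ℂ P q).toLinearMap)
            rw [Module.finrank_self] at h3
            omega
          obtain ⟨w, hw⟩ := (Module.finrank_pos_iff_exists_ne_zero (R := ℂ)).1 h1
          exact ⟨w, w.2, by simpa using hw⟩
        have hsq : ContDiff ℝ 2 (fun w : ℂ ↦ ‖w - s‖ ^ 2) :=
          ContDiff.norm_sq ℝ (contDiff_id.sub contDiff_const)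
        have hPR : ContDiff ℝ 2 P := hP.restrict_scalars ℝ
        have hpen : ContDiffAt ℝ 2 (fun z ↦ ‖P z - s‖ ^ 2) q := (hsq.comp hPR).contDiffAt
        have hpenL : leviForm (fun z ↦ ‖P z - s‖ ^ 2) q v = 0 := by
          have := leviForm_comp (f := fun w : ℂ ↦ ‖w - s‖ ^ 2) (g := P) (z := q)
            hsq.contDiffAt hP.contDiffAt v
          rw [hv, leviForm_zero_right] at this
          exact this
        have hεNC : ContDiffAt ℝ 2 (fun z ↦ ε * N z) q := contDiffAt_const.mul hN.contDiffAt
        have hpenK : ContDiffAt ℝ 2 (fun z ↦ -K * ‖P z - s‖ ^ 2) q := contDiffAt_const.mul hpen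
        have huL : leviForm u q v = ε * leviForm N q v := by
          rw [hu, leviForm_add (hbC.add hεNC) hpenK, leviForm_add hbC hεNC,
            leviForm_const_mul _ hN.contDiffAt, leviForm_const_mul _ hpen, hpenL, hbL]
          ring
        have huC : ContDiffAt ℝ 2 u q := (hbC.add hεNC).add hpenK
        have h1 : leviForm u q v ≤ 0 := by
          have h2 := hlocal.fderiv_fderiv_nonpos huC v
          have h3 := hlocal.fderiv_fderiv_nonpos huC (Complex.I • v)
          simp only [leviForm, iteratedFDeriv_two_apply, Matrix.cons_val_zero, Matrix.cons_val_one]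
          linarith
        have := mul_pos hε (hNpos q v hv0)
        linarith
      · -- On the sphere `Re P` stays away from `Re s`, so the penalty outweighs `b`.
        have h1 := hre q hq hqΩ
        rw [← dist_eq_norm, hqs] at h1
        have h2 : δ ≤ ‖P q - s‖ := by
          have h3 := Complex.abs_re_le_norm (P q - s)
          rw [Complex.sub_re] at h3
          linarith [neg_abs_le ((P q).re - s.re)]
        have h4 : |C| ≤ K * ‖P q - s‖ ^ 2 := by
          calc |C| = K * δ ^ 2 := by rw [hK]; field_simp
            _ ≤ _ := by gcongr
        have h5 := hC q hq
        have h6 := le_abs_self C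
        simp only [hu]
        linarith
    · have h1 := hb0 q hq hqΩ
      have h2 : 0 ≤ K * ‖P q - s‖ ^ 2 := by positivity
      simp only [hu]
      linarith
  -- Take `ε` so small that `ε R < b z₀`; `R + 1` is used because `R` may vanish.
  by_contra! hcon
  have h1 := key (b z₀ / (2 * (R + 1))) (by positivity)
  have h2 : b z₀ / (2 * (R + 1)) * R ≤ b z₀ / 2 := by
    rw [div_mul_eq_mul_div, div_le_div_iff₀ (by positivity) (by positivity)]
    nlinarith
  linarith

end Peak

/-! ### The identity theorem on a ball -/

section Identity

variable {E : Type*} [NormedAddCommGroup E] [NormedSpace ℂ E]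

/-- The identity theorem on a ball: on complex lines the function is harmonic, hence analytic. -/
theorem eqOn_zero_ball_of_pluriharmonic {b : E → ℝ} {a y : E} {r : ℝ}
    (hb : ∀ z ∈ Metric.ball a r, ContDiffAt ℝ 2 b z ∧ ∀ v, leviForm b z v = 0)
    (hy : y ∈ Metric.ball a r) (h0 : b =ᶠ[𝓝 y] 0) : Set.EqOn b 0 (Metric.ball a r) := by
  intro z hz
  set l : ℂ → E := fun t ↦ y + t • (z - y) with hl
  have hlC : ContDiff ℂ 2 l := by fun_prop
  have hlc : Continuous l := hlC.continuous
  have hl0 : l 0 = y := by simp [hl]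
  have hl1 : l 1 = z := by simp [hl]
  have hopen : IsOpen (l ⁻¹' Metric.ball a r) := Metric.isOpen_ball.preimage hlc
  have hconv : Convex ℝ (l ⁻¹' Metric.ball a r) := by
    intro s hs t ht p q hp hq hpq
    have h1 := convex_ball a r hs ht hp hq hpq
    have h2 : l (p • s + q • t) = p • l s + q • l t := by
      have hq' : q = 1 - p := by linarith
      subst hq'
      simp only [hl, add_smul, smul_add, smul_assoc, sub_smul, one_smul]
      abel
    rw [Set.mem_preimage, h2]
    exact h1
  have hharm (t : ℂ) (ht : t ∈ l ⁻¹' Metric.ball a r) :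
      InnerProductSpace.HarmonicAt (b ∘ l) t := by
    refine ⟨(hb _ ht).1.comp t (hlC.restrict_scalars ℝ).contDiffAt, ?_⟩
    filter_upwards [hopen.mem_nhds ht] with t' ht'
    have h1 := leviForm_comp (hb _ ht').1 hlC.contDiffAt 1
    rw [(hb _ ht').2] at h1
    rw [InnerProductSpace.laplacian_eq_iteratedFDeriv_complexPlane]
    simp only [leviForm, smul_eq_mul, mul_one] at h1
    simp only [Pi.zero_apply]
    linarith
  have han : AnalyticOnNhd ℝ (b ∘ l) (l ⁻¹' Metric.ball a r) :=
    fun t ht ↦ HarmonicAt.analyticAt (hharm t ht)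
  have hzero : b ∘ l =ᶠ[𝓝 0] 0 := by
    have : Filter.Tendsto l (𝓝 0) (𝓝 y) := hl0 ▸ hlc.continuousAt.tendsto
    exact this.eventually h0
  have := han.eqOn_zero_of_preconnected_of_eventuallyEq_zero hconv.isPreconnected
    (show (0 : ℂ) ∈ l ⁻¹' Metric.ball a r by rw [Set.mem_preimage, hl0]; exact hy) hzero
    (show (1 : ℂ) ∈ l ⁻¹' Metric.ball a r by rw [Set.mem_preimage, hl1]; exact hz)
  simpa [hl1] using this

end Identity

/-! ### Pluriharmonic functions on complex manifolds -/

section Manifold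

variable {E : Type*} [NormedAddCommGroup E] [NormedSpace ℂ E]
  {X : Type*} [TopologicalSpace X] [ChartedSpace E X]

theorem ContMDiffAt.contDiffAt_comp_chartAt_symm {f : X → ℝ} {x : X} {n : WithTop ℕ∞}
    (h : ContMDiffAt 𝓘(ℝ, E) 𝓘(ℝ, ℝ) n f x) :
    ContDiffAt ℝ n (f ∘ (chartAt E x).symm) (chartAt E x x) := by
  have := (contMDiffAt_iff.1 h).2
  simpa [contDiffWithinAt_univ, Function.comp_def, chartAt_self_eq] using this

/-- A pluriharmonic function is pluriharmonic in every preferred chart, also at points other than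
the base point of the chart. -/
theorem IsPluriharmonicOn.comp_chartAt_symm [IsManifold 𝓘(ℂ, E) ω X] {M : Set X} {β : X → ℝ}
    (hβ : IsPluriharmonicOn E β M) (hM : IsOpen M) (p : X) {z : E}
    (hz : z ∈ (chartAt E p).target) (hzM : (chartAt E p).symm z ∈ M) :
    ContDiffAt ℝ 2 (β ∘ (chartAt E p).symm) z ∧
      ∀ v, leviForm (β ∘ (chartAt E p).symm) z v = 0 := by
  set e := chartAt E p
  set x := e.symm z with hx
  set e' := chartAt E x
  have hxs : x ∈ e'.source := mem_chart_source E x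
  have hC : ContDiffAt ℝ 2 (β ∘ e'.symm) (e' x) :=
    (hβ.1.contMDiffAt (hM.mem_nhds hzM)).contDiffAt_comp_chartAt_symm
  have hsrc : z ∈ (e.symm ≫ₕ e').source := by
    simpa [hz] using hxs
  have hg : ContDiffAt ℂ 2 (e' ∘ e.symm) z := by
    have h1 := contDiffOn_ext_coord_change (I := 𝓘(ℂ, E)) (n := ω) x p
    rw [ext_coord_change_source] at h1
    have h2 : ContDiffAt ℂ ω (e' ∘ e.symm) z :=
      h1.contDiffAt (by
        rw [modelWithCornersSelf_coe, Set.image_id]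
        exact (e.symm ≫ₕ e').open_source.mem_nhds hsrc)
    exact h2.of_le le_top
  have hev : β ∘ e.symm =ᶠ[𝓝 z] (β ∘ e'.symm) ∘ (e' ∘ e.symm) := by
    filter_upwards [(e.symm ≫ₕ e').open_source.mem_nhds hsrc] with y hy
    have hy' : e.symm y ∈ e'.source := by
      rw [OpenPartialHomeomorph.trans_source] at hy
      exact hy.2
    simp [e'.left_inv hy']
  refine ⟨(hC.comp z (hg.restrict_scalars ℝ)).congr_of_eventuallyEq hev, fun v ↦ ?_⟩
  rw [hev.leviForm_eq, leviForm_comp (g := e' ∘ e.symm) hC hg]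
  exact hβ.2 x hzM _

theorem continuous_indicator_of_tendsto_frontier {Y : Type*} [TopologicalSpace Y] {M : Set Y}
    (hM : IsOpen M) {β : Y → ℝ} (hβ : ContinuousOn β M)
    (hβ0 : ∀ p ∈ frontier M, Filter.Tendsto β (𝓝[M] p) (𝓝 0)) :
    Continuous (M.indicator β) := by
  refine continuous_iff_continuousAt.2 fun p ↦ ?_
  by_cases hp : p ∈ M
  · refine (hβ.continuousAt (hM.mem_nhds hp)).congr ?_
    filter_upwards [hM.mem_nhds hp] with y hy
    rw [Set.indicator_of_mem hy]
  · rw [ContinuousAt, Set.indicator_of_notMem hp, ← nhdsWithin_univ, ← Set.union_compl_self M,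
      nhdsWithin_union, Filter.tendsto_sup]
    constructor
    · have h1 : Filter.Tendsto β (𝓝[M] p) (𝓝 0) := by
        by_cases hpc : p ∈ closure M
        · exact hβ0 p (hM.frontier_eq ▸ ⟨hpc, hp⟩)
        · rw [notMem_closure_iff_nhdsWithin_eq_bot.1 hpc]
          exact Filter.tendsto_bot
      refine h1.congr' ?_
      filter_upwards [self_mem_nhdsWithin] with y hy
      rw [Set.indicator_of_mem hy]
    · refine tendsto_const_nhds.congr' ?_
      filter_upwards [self_mem_nhdsWithin] with y hy
      rw [Set.indicator_of_notMem hy]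

/-- A pluriharmonic function with zero boundary values vanishes near a strongly pseudoconvex
boundary point. -/
theorem IsPluriharmonicOn.exists_eventuallyEq_zero [FiniteDimensional ℂ E]
    (hdim : 2 ≤ Module.finrank ℂ E) [IsManifold 𝓘(ℂ, E) ω X] {M : Set X} (hM : IsOpen M)
    (hpsc : HasStronglyPseudoconvexBoundary E M) {β : X → ℝ} (hβ : IsPluriharmonicOn E β M)
    (hβ0 : ∀ p ∈ frontier M, Filter.Tendsto β (𝓝[M] p) (𝓝 0)) {p : X} (hp : p ∈ frontier M) :
    ∃ x ∈ M, β =ᶠ[𝓝 x] 0 := by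
  obtain ⟨U, φ, hU, hpU, hφ, -, hMφ, hlevi⟩ := hpsc p hp
  rw [hM.frontier_eq] at hp
  set e := chartAt E p with he
  set a := e p with ha
  have hps : p ∈ e.source := mem_chart_source E p
  have hpa : e.symm a = p := e.left_inv hps
  have hat : a ∈ e.target := e.map_source hps
  have hF : ContDiffAt ℝ 2 (φ ∘ e.symm) a :=
    ((hφ.contMDiffAt (hU.mem_nhds hpU)).contDiffAt_comp_chartAt_symm).of_le
      (WithTop.coe_le_coe.2 le_top)
  obtain ⟨P, c, hP, hPa, hc, hgrow⟩ := exists_levi_polynomial hF (hlevi p hpU)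
  -- `p ∉ M` because `M` is open.
  have hφp : 0 ≤ φ p := not_lt.1 fun h ↦ hp.2 ((hMφ p hpU).2 h)
  have hsymm : ContinuousAt e.symm a := e.continuousAt_symm hat
  obtain ⟨r, hr, hball⟩ := Metric.nhds_basis_closedBall.eventually_iff.1
    (hgrow.and ((e.open_target.eventually_mem hat).and
      (hsymm.eventually (by rw [hpa]; exact hU.eventually_mem hpU))))
  have hcont := continuous_indicator_of_tendsto_frontier hM hβ.1.continuousOn hβ0
  set b : E → ℝ := M.indicator β ∘ e.symm with hb
  have hbc : ContinuousOn b (Metric.closedBall a r) :=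
    hcont.comp_continuousOn (e.continuousOn_symm.mono fun z hz ↦ (hball hz).2.1)
  have hb0 : ∀ z ∈ Metric.closedBall a r, z ∉ e.symm ⁻¹' M → b z = 0 :=
    fun z _ hz ↦ Set.indicator_of_notMem (s := M) hz β
  have hbp : ∀ z ∈ Metric.ball a r, z ∈ e.symm ⁻¹' M →
      ContDiffAt ℝ 2 b z ∧ ∀ v, leviForm b z v = 0 := by
    intro z hz hzM
    have hzt := (hball (Metric.ball_subset_closedBall hz)).2.1
    obtain ⟨h1, h2⟩ := hβ.comp_chartAt_symm hM p hzt hzM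
    have hev : b =ᶠ[𝓝 z] β ∘ e.symm := by
      filter_upwards [(e.continuousAt_symm hzt).eventually (hM.eventually_mem hzM)] with y hy
      exact Set.indicator_of_mem hy β
    exact ⟨h1.congr_of_eventuallyEq hev, fun v ↦ (hev.leviForm_eq v).trans (h2 v)⟩
  have hre : ∀ z ∈ Metric.closedBall a r, z ∈ e.symm ⁻¹' M →
      (P z).re ≤ -(c * ‖z - a‖ ^ 2) := by
    intro z hz hzM
    obtain ⟨h1, -, h2⟩ := hball hz
    have h3 := (hMφ _ h2).1 hzM
    simp only [Function.comp_apply, hpa] at h1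
    linarith
  set V := Metric.ball a r ∩ {z | -(c * r ^ 2) < (P z).re} with hV
  have hVo : IsOpen V := Metric.isOpen_ball.inter
    (isOpen_lt continuous_const (Complex.continuous_re.comp hP.continuous))
  have haV : a ∈ V := ⟨Metric.mem_ball_self hr, by
    simp only [Set.mem_ofPred_eq, hPa, Complex.zero_re]
    have := mul_pos hc (pow_pos hr 2)
    linarith⟩
  have hbV : ∀ z ∈ V, b z = 0 := by
    rintro z ⟨hz, hz'⟩
    have hz := Metric.ball_subset_closedBall hz
    refine le_antisymm (nonpos_of_re_lt_of_pluriharmonic hdim hbc hb0 hbp hP hre hz hz') ?_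
    have := nonpos_of_re_lt_of_pluriharmonic hdim (b := fun y ↦ -1 * b y)
      (continuousOn_const.mul hbc) (fun y hy hyM ↦ by simp [hb0 y hy hyM])
      (fun y hy hyM ↦ ⟨contDiffAt_const.mul (hbp y hy hyM).1, fun v ↦ by
        rw [leviForm_const_mul _ (hbp y hy hyM).1, (hbp y hy hyM).2, mul_zero]⟩) hP hre hz hz'
    linarith
  have hWo : IsOpen (e.source ∩ e ⁻¹' V) := e.isOpen_inter_preimage hVo
  obtain ⟨x, hxW, hxM⟩ := mem_closure_iff.1 hp.1 _ hWo ⟨hps, haV⟩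
  refine ⟨x, hxM, ?_⟩
  filter_upwards [hWo.mem_nhds hxW, hM.mem_nhds hxM] with y hy hyM
  have h1 := hbV _ hy.2
  simpa [hb, e.left_inv hy.1, Set.indicator_of_mem hyM] using h1

/-- The identity theorem for pluriharmonic functions on a domain. -/
theorem IsPluriharmonicOn.eqOn_zero_of_isPreconnected [IsManifold 𝓘(ℂ, E) ω X] {M : Set X}
    (hM : IsOpen M) (hconn : IsPreconnected M) {β : X → ℝ} (hβ : IsPluriharmonicOn E β M)
    {x₀ : X} (hx₀ : x₀ ∈ M) (h0 : β =ᶠ[𝓝 x₀] 0) : Set.EqOn β 0 M := by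
  set S : Set X := {x | β =ᶠ[𝓝 x] 0} with hS
  have hSo : IsOpen S := isOpen_setOfPred_eventually_nhds
  have hsub : M ⊆ S := by
    refine hconn.subset_of_closure_inter_subset hSo ⟨x₀, hx₀, h0⟩ ?_
    rintro x ⟨hxc, hxM⟩
    set e := chartAt E x with he
    have hxs : x ∈ e.source := mem_chart_source E x
    have hxt : e x ∈ e.target := e.map_source hxs
    obtain ⟨r, hr, hball⟩ := Metric.eventually_nhds_iff_ball.1
      ((e.open_target.eventually_mem hxt).and ((e.continuousAt_symm hxt).eventually
        (by rw [e.left_inv hxs]; exact hM.eventually_mem hxM)))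
    have hWo : IsOpen (e.source ∩ e ⁻¹' Metric.ball (e x) r) :=
      e.isOpen_inter_preimage Metric.isOpen_ball
    have hxW : x ∈ e.source ∩ e ⁻¹' Metric.ball (e x) r := ⟨hxs, Metric.mem_ball_self hr⟩
    obtain ⟨y, hyW, hyS⟩ := mem_closure_iff.1 hxc _ hWo hxW
    have hev : β ∘ e.symm =ᶠ[𝓝 (e y)] 0 := by
      have h1 := e.continuousAt_symm (e.map_source hyW.1)
      rw [ContinuousAt, e.left_inv hyW.1] at h1
      exact h1.eventually hyS
    have hzero := eqOn_zero_ball_of_pluriharmonic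
      (fun z hz ↦ hβ.comp_chartAt_symm hM x (hball z hz).1 (hball z hz).2) hyW.2 hev
    filter_upwards [hWo.mem_nhds hxW] with w hw
    have h1 := hzero hw.2
    rwa [Function.comp_apply, e.left_inv hw.1] at h1
  exact fun x hx ↦ (hsub hx).self_of_nhds

end Manifold

theorem mainTheorem6
    {E : Type*} [NormedAddCommGroup E] [NormedSpace ℂ E] [FiniteDimensional ℂ E]
    (hdim : 2 ≤ Module.finrank ℂ E)
    {X : Type*} [TopologicalSpace X] [T2Space X] [ChartedSpace E X] [IsManifold 𝓘(ℂ, E) ω X]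
    (M : Set X) (hMopen : IsOpen M) (hMconn : IsConnected M)
    (hcompact : IsCompact (frontier M)) (hnonempty : (frontier M).Nonempty)
    (hpsc : HasStronglyPseudoconvexBoundary E M)
    (β : X → ℝ) (hβ : IsPluriharmonicOn E β M)
    (hβ0 : ∀ p ∈ frontier M, Filter.Tendsto β (𝓝[M] p) (𝓝 0)) :
    ∀ x ∈ M, β x = 0 := by
  obtain ⟨p, hp⟩ := hnonempty
  obtain ⟨x₀, hx₀, h0⟩ := hβ.exists_eventuallyEq_zero hdim hMopen hpsc hβ0 hp
  exact hβ.eqOn_zero_of_isPreconnected hMopen hMconn.isPreconnected hx₀ h0
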